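/- Let $G=(\mathcal V,\mathcal E)$ be a finite directed graph ($\mathcal E\subseteq\mathcal V\times\mathcal V$), and let each edge $e\in\mathcal E$ carry a memoryless channel with finite input alphabet $\mathsf X_e$, finite output alphabet $\mathsf Y_e$ and transition law $K_e$, the channels of different edges being independent. The observations $W_v$, $v\in\mathcal V$, are i.i.d. $N(0,1)$ random variables, node $v$ observes $W_v$, and every node wants to compute $Z=\sum_{v\in\mathcal V}a_vW_v$, where $(a_v)_{v\in\mathcal V}$ are real numbers, all nonzero. A $T$-step algorithm ($T\in\{0,1,2,\dots\}$) consists of deterministic measurable encoders and estimators: at each time $t=1,\dots,T$ every node $v$ computes from $W_v$ and from the symbols it received on its incoming edges at times $1,\dots,t-1$ one input symbol for each of its outgoing edges, and sends these symbols over the channels; the outputs at time $t$ have, given the inputs at time $t$, the law $\bigotimes_{e}K_e$, independently of $W$ and of all earlier inputs and outputs. After time $T$ node $v$ computes an estimate $\widehat Z_v\in\mathbb R$ from $W_v$ and from all the symbols it received. For $\varepsilon\ge 0$ and $\delta\in[0,1)$ let $$T(\varepsilon,\delta)=\inf\Big\{T\in\{0,1,2,\dots\}:\ \text{some } T\text{-step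 algorithm satisfies } \max_{v\in\mathcal V}\mathbb P\big[|Z-\widehat Z_v|>\varepsilon\big]\le\delta\Big\},\qquad \inf\emptyset=\infty.$$ Let $C_e$ be the Shannon capacity (in bits) of the channel $K_e$; for $\mathcal S\subset\mathcal V$ with complement $\mathcal S^c$ let $C_{\mathcal S}=\sum_{(u,v)\in\mathcal E:\,u\in\mathcal S^c,\,v\in\mathcal S}C_{(u,v)}$ and $\|a_{\mathcal S^c}\|_2^2=\sum_{v\in\mathcal S^c}a_v^2$. All logarithms are binary, and $h_2(\delta)=-\delta\log\delta-(1-\delta)\log(1-\delta)$, with $0\log 0=0$. Suppose that $\varepsilon\ge 0$, $\delta\in[0,1)$ and $$\varepsilon\le\sqrt{\frac{\pi}{2}}\,(1-\delta)\min_{v\in\mathcal V}|a_v|.$$ Then $$T(\varepsilon,\delta)\ \ge\ \max_{\emptyset\ne\mathcal S\subsetneq\mathcal V}\ \frac1{C_{\mathcal S}}\left(\frac{1-\delta}{2}\log\frac{\pi\|a_{\mathcal S^c}\|_2^2}{2\varepsilon^2}-h_2(\delta)\right).$$ Here the logarithm is $+\infty$ if $\varepsilon=0$; if $C_{\mathcal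 S}=0$, the quotient is $+\infty$ when the expression in parentheses is positive, and it imposes no condition otherwise. -/

import Mathlib

open MeasureTheory ProbabilityTheory
open scoped ENNReal

noncomputable section

/-- A network: a directed graph on a finite set `V` of nodes (an edge `(u, v)` goes from `u` to `v`),
together with a memoryless channel `K e` on each edge `e`, with finite input alphabet `X e` and finite
output alphabet `Y e`; `K e x y` is the probability of the output `y` given the input `x`. -/
structure Network (V : Type*) where
  edges : Finset (V × V)
  X : edges → Type*
  Y : edges → Type*
  [fintypeX : ∀ e, Fintype (X e)]
  [fintypeY : ∀ e, Fintype (Y e)]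
  K : ∀ e, X e → Y e → ℝ
  K_nonneg : ∀ e x y, 0 ≤ K e x y
  K_sum : ∀ e x, ∑ y, K e x y = 1

namespace Network

attribute [instance] Network.fintypeX Network.fintypeY

variable {V : Type*}

/-- The finite alphabets carry the discrete σ-algebra. -/
instance instMeasurableSpaceX (N : Network V) (e : N.edges) : MeasurableSpace (N.X e) := ⊤

instance instMeasurableSpaceY (N : Network V) (e : N.edges) : MeasurableSpace (N.Y e) := ⊤

/-- The edges that enter the node `v`. -/
abbrev In (N : Network V) (v : V) : Type _ := {e : N.edges // e.1.2 = v}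

/-- The edges that leave the node `v`. -/
abbrev Out (N : Network V) (v : V) : Type _ := {e : N.edges // e.1.1 = v}

/-- A `T`-step algorithm with local observations in `W v` and estimates in `Z`. Time runs over
`0, …, T - 1`, so that at time `t` a node has received `t` rounds of messages. -/
structure Algorithm (N : Network V) (W : V → Type*) [∀ v, MeasurableSpace (W v)]
    (Z : Type*) [MeasurableSpace Z] (T : ℕ) where
  /-- the encoders -/
  enc : ∀ (v : V) (t : Fin T), W v → (Fin t → ∀ e : N.In v, N.Y e.1) → ∀ e : N.Out v, N.X e.1
  /-- the estimators -/
  est : ∀ v : V, W v → (Fin T → ∀ e : N.In v, N.Y e.1) → Z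
  measurable_enc : ∀ v t y, Measurable fun w => enc v t w y
  measurable_est : ∀ v y, Measurable fun w => est v w y

section Law

variable {N : Network V} {W : V → Type*} [∀ v, MeasurableSpace (W v)]
  {Z : Type*} [MeasurableSpace Z] {T : ℕ}

/-- The symbol that the algorithm sends along the edge `e` at time `t`, when the observations are `w`
and the symbols received on all the edges are `y`. -/
def Algorithm.input (A : N.Algorithm W Z T) (w : ∀ v, W v) (y : Fin T → ∀ e, N.Y e)
    (t : Fin T) (e : N.edges) : N.X e :=
  A.enc e.1.1 t (w e.1.1) (fun s e' => y (Fin.castLE t.is_lt.le s) e'.1) ⟨e, rfl⟩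

/-- The estimate of the node `v` at time `T`. -/
def Algorithm.estimate (A : N.Algorithm W Z T) (v : V)
    (p : (∀ v, W v) × (Fin T → ∀ e, N.Y e)) : Z :=
  A.est v (p.1 v) (fun t e => p.2 t e.1)

/-- The joint law of the observations and of all the received symbols, when the observations have the
law `μ`: `P(dw, y) = μ(dw) ∏ₜ ∏ₑ Kₑ(y_{e,t} | x_{e,t})`. -/
def Algorithm.jointLaw (A : N.Algorithm W Z T) (μ : Measure (∀ v, W v)) :
    Measure ((∀ v, W v) × (Fin T → ∀ e, N.Y e)) :=
  Measure.sum fun y : Fin T → ∀ e, N.Y e =>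
    (μ.withDensity fun w =>
      ∏ t, ∏ e, ENNReal.ofReal (N.K e (A.input w y t e) (y t e))).map fun w => (w, y)

end Law

/-- The `(ε, δ)`-computation time of `f` under the distortion `d`, when the observations have the law
`μ`; it is `⊤` if no algorithm achieves the required accuracy. -/
def computationTime (N : Network V) {W : V → Type*} [∀ v, MeasurableSpace (W v)]
    {Z : Type*} [MeasurableSpace Z] (μ : Measure (∀ v, W v)) (f : (∀ v, W v) → Z)
    (d : Z → Z → ℝ) (ε δ : ℝ) : ℕ∞ :=
  ⨅ T ∈ {T : ℕ | ∃ A : N.Algorithm W Z T, ∀ v,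
    A.jointLaw μ {p | ε < d (f p.1) (A.estimate v p)} ≤ ENNReal.ofReal δ}, (T : ℕ∞)

/-- The mutual information in bits between the input and the output of the channel `K`, for the
input distribution `p`. -/
def mutualInfo {X Y : Type*} [Fintype X] [Fintype Y] (p : X → ℝ) (K : X → Y → ℝ) : ℝ :=
  ∑ x, ∑ y, p x * K x y * Real.logb 2 (K x y / ∑ x', p x' * K x' y)

/-- The Shannon capacity in bits of the channel `K`. -/
def capacity {X Y : Type*} [Fintype X] [Fintype Y] (K : X → Y → ℝ) : ℝ≥0∞ :=
  ⨆ p ∈ stdSimplex ℝ X, ENNReal.ofReal (mutualInfo p K)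

/-- The cutset capacity of `S`: the sum of the capacities of the channels from `Sᶜ` to `S`. -/
def cutsetCapacity [DecidableEq V] (N : Network V) (S : Finset V) : ℝ≥0∞ :=
  ∑ e : N.edges with e.1.1 ∉ S ∧ e.1.2 ∈ S, capacity (N.K e)

end Network

/-- The extended binary logarithm, with `log₂ 0 = -∞` and `log₂ ∞ = ∞`. -/
def binLog (x : ℝ≥0∞) : EReal := ENNReal.log x / ((Real.log 2 : ℝ) : EReal)

/-- The binary entropy function in bits. -/
def binEntropyBits (δ : ℝ) : ℝ := -δ * Real.logb 2 δ - (1 - δ) * Real.logb 2 (1 - δ)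

/-- `(1 - δ) / 2 * log₂ (π ‖a_{Sᶜ}‖² / (2 ε²)) - h₂(δ)`; it is `⊤` if `ε = 0`, `δ < 1` and
`a_{Sᶜ} ≠ 0`. -/
def gaussianSumInfo {V : Type*} [Fintype V] [DecidableEq V] (a : V → ℝ) (S : Finset V) (ε δ : ℝ) :
    EReal :=
  (((1 - δ) / 2 : ℝ) : EReal) *
      binLog (ENNReal.ofReal (Real.pi * ∑ v ∈ Sᶜ, a v ^ 2) / ENNReal.ofReal (2 * ε ^ 2)) -
    ((binEntropyBits δ : ℝ) : EReal)

end

/-! The bound is a cutset argument by change of measure. Fix `S`, a node `v ∈ S`, a node `u ∉ S`,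
and a `T`-step algorithm. Compare its true law with a reference law in which every channel from `Sᶜ`
to `S` is cut and emits, at each time, independent noise distributed as the true output of that
channel at that time (`outputLaw`).

Under the reference law what `S` receives depends on the observations in `S` only
(`sum_refLikelihood_mul`). The rest of the sum is an independent Gaussian of variance `σ = ∑ v ∈ Sᶜ,
a v ^ 2`, with density at most `1 / √(2πσ)`, so node `v` comes within `ε` of the sum with
probability at most `L = 2ε / √(2πσ)` (`sum_integral_refLikelihood_le`). Under the true law it does
so with probability at least `1 - δ`.

The two laws differ only in the cut factors, and the noise is a product. Their divergence is
therefore a sum over times and cut edges of expected information densities, each the mutual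
information of one channel use; the total is at most `T` times the cutset capacity
(`ofReal_sum_information_le`). No chain rule is needed.

Data processing for the event of a good estimate (`change_of_measure`, `binary_divergence_le`) gives
`(1 - δ) log (1 / L) - h(δ) ≤ T C_S`, and `L ^ 2 = 2ε² / (πσ)`. The case `ε = 0` follows by letting
a positive accuracy tend to zero. -/

noncomputable section

/-! ### Trajectories weighted by causal kernels -/

/-- Extending a trajectory by a last symbol splits the sum over trajectories. -/
theorem sum_fin_succ_pi {Y : Type*} [Fintype Y] {T : ℕ} (F : (Fin (T + 1) → Y) → ℝ) :
    ∑ y, F y = ∑ y : Fin T → Y, ∑ b : Y, F (Fin.snoc (α := fun _ => Y) y b) := by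
  rw [← (Fin.snocEquiv fun _ : Fin (T + 1) => Y).sum_comp, Fintype.sum_prod_type, Finset.sum_comm]
  rfl

/-- The weight of a trajectory under a causal kernel. -/
def causalWeight {Y : Type*} {T : ℕ} (M : ∀ t : Fin T, (Fin t → Y) → Y → ℝ) (y : Fin T → Y) : ℝ :=
  ∏ t, M t (fun s => y (Fin.castLE t.is_lt.le s)) (y t)

theorem causalWeight_snoc {Y : Type*} {T : ℕ} (M : ∀ t : Fin (T + 1), (Fin t → Y) → Y → ℝ)
    (y : Fin T → Y) (b : Y) :
    causalWeight M (Fin.snoc (α := fun _ => Y) y b) =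
      causalWeight (fun t : Fin T => M t.castSucc) y * M (Fin.last T) y b := by
  unfold causalWeight
  rw [Fin.prod_univ_castSucc]
  congr 1
  · refine Finset.prod_congr rfl fun t _ => ?_
    congr 1
    · funext s
      exact Fin.snoc_castSucc (α := fun _ => Y) b y (Fin.castLE t.is_lt.le s)
    · exact Fin.snoc_castSucc (α := fun _ => Y) b y t
  · congr 1
    · funext s
      exact Fin.snoc_castSucc (α := fun _ => Y) b y s
    · exact Fin.snoc_last (α := fun _ => Y) b y

theorem sum_causalWeight_succ {Y : Type*} [Fintype Y] {T : ℕ}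
    (M : ∀ t : Fin (T + 1), (Fin t → Y) → Y → ℝ) :
    ∑ y, causalWeight M y = ∑ y, causalWeight (fun t : Fin T => M t.castSucc) y *
      ∑ b, M (Fin.last T) y b := by
  rw [sum_fin_succ_pi]
  simp_rw [causalWeight_snoc, Finset.mul_sum]

theorem sum_causalWeight {Y : Type*} [Fintype Y] {T : ℕ}
    (M : ∀ t : Fin T, (Fin t → Y) → Y → ℝ) (hM : ∀ t h, ∑ b, M t h b = 1) :
    ∑ y, causalWeight M y = 1 := by
  induction T with
  | zero => simp [causalWeight]
  | succ T ih =>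
    rw [sum_causalWeight_succ, ← ih (fun t => M t.castSucc) fun t h => hM t.castSucc h]
    exact Finset.sum_congr rfl fun y _ => by rw [hM (Fin.last T) y, mul_one]

/-- Changing a causal kernel at one time, without changing its total mass there, does not change
the total weight of the trajectories if the kernel is stochastic at all later times. -/
theorem sum_causalWeight_congr {Y : Type*} [Fintype Y] {T : ℕ}
    (M M' : ∀ t : Fin T, (Fin t → Y) → Y → ℝ) (t₀ : Fin T) (heq : ∀ t, t ≠ t₀ → M t = M' t)
    (hM : ∀ t, t₀ < t → ∀ h, ∑ b, M t h b = 1) (h₀ : ∀ h, ∑ b, M t₀ h b = ∑ b, M' t₀ h b) :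
    ∑ y, causalWeight M y = ∑ y, causalWeight M' y := by
  induction T with
  | zero => exact t₀.elim0
  | succ T ih =>
    rw [sum_causalWeight_succ, sum_causalWeight_succ]
    induction t₀ using Fin.lastCases with
    | last =>
      refine Finset.sum_congr rfl fun y _ => ?_
      rw [show (fun t : Fin T => M t.castSucc) = fun t : Fin T => M' t.castSucc from
        funext fun t => heq t.castSucc (Fin.castSucc_lt_last t).ne]
      congr 1
      exact h₀ y
    | cast t₀ =>
      -- The last time is later than `t₀`, so both final kernels have mass one and drop out of the
      -- sums.
      have h1 : ∀ y : Fin T → Y, ∑ b, M (Fin.last T) y b = 1 := fun y =>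
        hM (Fin.last T) (Fin.castSucc_lt_last t₀) y
      have h2 : ∀ y : Fin T → Y, ∑ b, M' (Fin.last T) y b = 1 := fun y => by
        rw [← heq _ (Fin.castSucc_lt_last t₀).ne']; exact h1 y
      simp_rw [h1, h2, mul_one]
      exact ih _ _ t₀ (fun t ht => heq _ fun h => ht (Fin.castSucc_injective _ h))
        (fun t ht h => hM t.castSucc (Fin.castSucc_lt_castSucc_iff.2 ht) h) h₀

/-- Summing a product over one coordinate `i₀` weighted by a function of that coordinate. -/
theorem sum_pi_prod_mul {ι : Type*} [Fintype ι] [DecidableEq ι] {κ : ι → Type*}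
    [∀ i, Fintype (κ i)] (f : ∀ i, κ i → ℝ) (i₀ : ι) (hf : ∀ i, i ≠ i₀ → ∑ b, f i b = 1)
    (φ : κ i₀ → ℝ) : ∑ y : ∀ i, κ i, (∏ i, f i (y i)) * φ (y i₀) = ∑ b, f i₀ b * φ b := by
  have h : ∀ y : ∀ i, κ i, (∏ i, f i (y i)) * φ (y i₀) =
      ∏ i, (Function.update f i₀ fun b => f i₀ b * φ b) i (y i) := fun y => by
    rw [← Finset.mul_prod_erase _ _ (Finset.mem_univ i₀),
      ← Finset.mul_prod_erase _ (fun i => (Function.update f i₀ fun b => f i₀ b * φ b) i (y i))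
        (Finset.mem_univ i₀), Function.update_self, mul_right_comm]
    congr 1
    refine Finset.prod_congr rfl fun i hi => ?_
    rw [Function.update_of_ne (Finset.ne_of_mem_erase hi)]
  simp_rw [h]
  rw [← Fintype.prod_sum, ← Finset.mul_prod_erase _ _ (Finset.mem_univ i₀), Function.update_self,
    Finset.prod_eq_one, mul_one]
  intro i hi
  rw [Function.update_of_ne (Finset.ne_of_mem_erase hi), hf i (Finset.ne_of_mem_erase hi)]

/-! ### Likelihood of the received symbols and the law of a single channel use -/

namespace Network

variable {V : Type*}

theorem K_le_one (N : Network V) (e : N.edges) (x : N.X e) (y : N.Y e) : N.K e x y ≤ 1 := by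
  rw [← N.K_sum e x]
  exact Finset.single_le_sum (fun b _ => N.K_nonneg e x b) (Finset.mem_univ y)

namespace Algorithm

variable {N : Network V} {W : V → Type*} [∀ v, MeasurableSpace (W v)]
  {Z : Type*} [MeasurableSpace Z] {T : ℕ}

/-- The conditional probability of the received symbols `y` given the observations `w`. -/
def likelihood (A : N.Algorithm W Z T) (w : ∀ v, W v) (y : Fin T → ∀ e, N.Y e) : ℝ :=
  ∏ t, ∏ e, N.K e (A.input w y t e) (y t e)

theorem likelihood_nonneg (A : N.Algorithm W Z T) (w : ∀ v, W v) (y : Fin T → ∀ e, N.Y e) :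
    0 ≤ A.likelihood w y :=
  Finset.prod_nonneg fun _ _ => Finset.prod_nonneg fun _ _ => N.K_nonneg _ _ _

theorem likelihood_le_one (A : N.Algorithm W Z T) (w : ∀ v, W v) (y : Fin T → ∀ e, N.Y e) :
    A.likelihood w y ≤ 1 :=
  Finset.prod_le_one (fun _ _ => Finset.prod_nonneg fun _ _ => N.K_nonneg _ _ _) fun _ _ =>
    Finset.prod_le_one (fun _ _ => N.K_nonneg _ _ _) fun _ _ => N.K_le_one _ _ _

theorem measurable_input (A : N.Algorithm W Z T) (y : Fin T → ∀ e, N.Y e) (t : Fin T)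
    (e : N.edges) : Measurable fun w => A.input w y t e :=
  (measurable_pi_apply (⟨e, rfl⟩ : N.Out e.1.1)).comp
    ((A.measurable_enc e.1.1 t _).comp (measurable_pi_apply e.1.1))

theorem measurable_comp_input {β : Type*} [MeasurableSpace β] (A : N.Algorithm W Z T)
    (y : Fin T → ∀ e, N.Y e) (t : Fin T) (e : N.edges) (φ : N.X e → β) :
    Measurable fun w => φ (A.input w y t e) :=
  (measurable_from_top (f := φ)).comp (A.measurable_input y t e)

theorem measurable_likelihood (A : N.Algorithm W Z T) (y : Fin T → ∀ e, N.Y e) :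
    Measurable fun w => A.likelihood w y :=
  Finset.measurable_prod _ fun t _ => Finset.measurable_prod _ fun e _ =>
    A.measurable_comp_input y t e fun x => N.K e x (y t e)

theorem integrable_likelihood_mul (A : N.Algorithm W Z T) (μ : Measure (∀ v, W v))
    [IsFiniteMeasure μ] (y : Fin T → ∀ e, N.Y e) {F : (∀ v, W v) → ℝ} (hF : Measurable F) {C : ℝ}
    (hC : ∀ w, |F w| ≤ C) : Integrable (fun w => A.likelihood w y * F w) μ := by
  refine Integrable.of_bound ((A.measurable_likelihood y).mul hF).aestronglyMeasurable C
    (.of_forall fun w => ?_)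
  rw [Real.norm_eq_abs, abs_mul, abs_of_nonneg (A.likelihood_nonneg w y)]
  exact (mul_le_of_le_one_left (abs_nonneg _) (A.likelihood_le_one w y)).trans (hC w)

/-- Functions of a channel input are integrable against the likelihood. -/
theorem integrable_likelihood_mul_comp (A : N.Algorithm W Z T) (μ : Measure (∀ v, W v))
    [IsFiniteMeasure μ] (y : Fin T → ∀ e, N.Y e) (t : Fin T) (e : N.edges) (φ : N.X e → ℝ) :
    Integrable (fun w => A.likelihood w y * φ (A.input w y t e)) μ :=
  A.integrable_likelihood_mul μ y (A.measurable_comp_input y t e φ) (C := ∑ x, |φ x|) fun _ =>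
    Finset.single_le_sum (f := fun x => |φ x|) (fun _ _ => abs_nonneg _) (Finset.mem_univ _)

/-- The symbol sent along `e` at time `t` when the observations are `w` and the symbols received
before time `t` are `h`. -/
def encInput (A : N.Algorithm W Z T) (w : ∀ v, W v) (t : Fin T) (h : Fin t → ∀ e, N.Y e)
    (e : N.edges) : N.X e :=
  A.enc e.1.1 t (w e.1.1) (fun s e' => h s e'.1) ⟨e, rfl⟩

/-- The probability that `b` is received at time `t`, given the past `h`. -/
def stepKernel (A : N.Algorithm W Z T) (w : ∀ v, W v) (t : Fin T) (h : Fin t → ∀ e, N.Y e)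
    (b : ∀ e, N.Y e) : ℝ :=
  ∏ e, N.K e (A.encInput w t h e) (b e)

theorem likelihood_eq_causalWeight (A : N.Algorithm W Z T) (w : ∀ v, W v)
    (y : Fin T → ∀ e, N.Y e) : A.likelihood w y = causalWeight (A.stepKernel w) y := rfl

variable [DecidableEq V]

theorem sum_stepKernel (A : N.Algorithm W Z T) (w : ∀ v, W v) (t : Fin T)
    (h : Fin t → ∀ e, N.Y e) : ∑ b, A.stepKernel w t h b = 1 := by
  unfold stepKernel
  rw [← Fintype.prod_sum]
  exact Finset.prod_eq_one fun e _ => N.K_sum e _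

theorem sum_likelihood (A : N.Algorithm W Z T) (w : ∀ v, W v) : ∑ y, A.likelihood w y = 1 :=
  sum_causalWeight _ (A.sum_stepKernel w)

/-- Given the input of a channel, its output has the law prescribed by the channel. -/
theorem sum_likelihood_mul (A : N.Algorithm W Z T) (w : ∀ v, W v) (t : Fin T) (e : N.edges)
    (φ : N.X e → N.Y e → ℝ) :
    ∑ y, A.likelihood w y * φ (A.input w y t e) (y t e) =
      ∑ y, A.likelihood w y * ∑ b, N.K e (A.input w y t e) b * φ (A.input w y t e) b := by
  -- A factor depending on the past and the present at time `t` can be absorbed into the kernel at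
  -- time `t`.
  have key : ∀ (G : (Fin t → ∀ e, N.Y e) → (∀ e, N.Y e) → ℝ) (y : Fin T → ∀ e, N.Y e),
      A.likelihood w y * G (fun s => y (Fin.castLE t.is_lt.le s)) (y t) =
        causalWeight (Function.update (A.stepKernel w) t
          fun h b => A.stepKernel w t h b * G h b) y := fun G y => by
    rw [likelihood_eq_causalWeight]
    unfold causalWeight
    rw [← Finset.mul_prod_erase _ _ (Finset.mem_univ t),
      ← Finset.mul_prod_erase Finset.univ
        (fun i => Function.update (A.stepKernel w) t _ i _ _) (Finset.mem_univ t),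
      Function.update_self, mul_right_comm]
    congr 1
    refine Finset.prod_congr rfl fun i hi => ?_
    rw [Function.update_of_ne (Finset.ne_of_mem_erase hi)]
  have key1 := fun y => key (fun h b => φ (A.encInput w t h e) (b e)) y
  have key2 := fun y => key
    (fun h _ => ∑ b, N.K e (A.encInput w t h e) b * φ (A.encInput w t h e) b) y
  refine (Finset.sum_congr rfl fun y _ => key1 y).trans
    (Eq.trans ?_ (Finset.sum_congr rfl fun y _ => (key2 y).symm))
  refine sum_causalWeight_congr _ _ t (fun s hs => ?_) (fun s hs h => ?_) fun h => ?_
  · rw [Function.update_of_ne hs, Function.update_of_ne hs]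
  · rw [Function.update_of_ne hs.ne']
    exact A.sum_stepKernel w s h
  -- Given the past, the coordinate `b e` has law `K e` at the current input. Averaging `φ` over it
  -- thus leaves the mass of the modified kernel at time `t` unchanged.
  · simp only [Function.update_self]
    rw [← Finset.sum_mul, sum_stepKernel, one_mul]
    exact sum_pi_prod_mul (fun e b => N.K e (A.encInput w t h e) b) e (fun e _ => N.K_sum e _)
      (φ (A.encInput w t h e))

open Classical in
/-- The law of the symbol sent along `e` at time `t`. -/
def inputLaw (A : N.Algorithm W Z T) (μ : Measure (∀ v, W v)) (t : Fin T) (e : N.edges)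
    (x : N.X e) : ℝ :=
  ∑ y, ∫ w, A.likelihood w y * (if A.input w y t e = x then 1 else 0) ∂μ

theorem inputLaw_nonneg (A : N.Algorithm W Z T) (μ : Measure (∀ v, W v)) (t : Fin T) (e : N.edges)
    (x : N.X e) : 0 ≤ A.inputLaw μ t e x :=
  Finset.sum_nonneg fun y _ => integral_nonneg fun w =>
    mul_nonneg (A.likelihood_nonneg w y) (by positivity)

theorem sum_integral_likelihood_mul_input (A : N.Algorithm W Z T) (μ : Measure (∀ v, W v))
    [IsFiniteMeasure μ] (t : Fin T) (e : N.edges) (ψ : N.X e → ℝ) :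
    ∑ y, ∫ w, A.likelihood w y * ψ (A.input w y t e) ∂μ = ∑ x, A.inputLaw μ t e x * ψ x := by
  classical
  unfold inputLaw
  simp_rw [Finset.sum_mul]
  rw [Finset.sum_comm]
  refine Finset.sum_congr rfl fun y _ => ?_
  simp_rw [← integral_mul_const]
  rw [← integral_finsetSum]
  · refine integral_congr_ae (.of_forall fun w => ?_)
    simp
  · intro x _
    exact (A.integrable_likelihood_mul_comp μ y t e fun x' => if x' = x then 1 else 0).mul_const _

theorem sum_inputLaw (A : N.Algorithm W Z T) (μ : Measure (∀ v, W v)) [IsProbabilityMeasure μ]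
    (t : Fin T) (e : N.edges) : ∑ x, A.inputLaw μ t e x = 1 := by
  have h := A.sum_integral_likelihood_mul_input μ t e fun _ => 1
  simp only [mul_one] at h
  rw [← h, ← integral_finsetSum]
  · simp [sum_likelihood]
  · intro y _
    simpa using A.integrable_likelihood_mul_comp μ y t e fun _ => 1

/-- The joint law of the input and the output of a channel. -/
theorem sum_integral_likelihood_mul (A : N.Algorithm W Z T) (μ : Measure (∀ v, W v))
    [IsFiniteMeasure μ] (t : Fin T) (e : N.edges) (φ : N.X e → N.Y e → ℝ) :
    ∑ y, ∫ w, A.likelihood w y * φ (A.input w y t e) (y t e) ∂μ =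
      ∑ x, ∑ b, A.inputLaw μ t e x * N.K e x b * φ x b := by
  simp_rw [mul_assoc, ← Finset.mul_sum]
  rw [← A.sum_integral_likelihood_mul_input μ t e fun x => ∑ b, N.K e x b * φ x b,
    ← integral_finsetSum, ← integral_finsetSum]
  · simp_rw [A.sum_likelihood_mul _ t e φ]
  · exact fun y _ => A.integrable_likelihood_mul_comp μ y t e fun x => ∑ b, N.K e x b * φ x b
  · exact fun y _ => A.integrable_likelihood_mul_comp μ y t e fun x => φ x (y t e)

/-- The law of the symbol received along `e` at time `t`. -/
def outputLaw (A : N.Algorithm W Z T) (μ : Measure (∀ v, W v)) (t : Fin T) (e : N.edges)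
    (b : N.Y e) : ℝ :=
  ∑ x, A.inputLaw μ t e x * N.K e x b

theorem outputLaw_nonneg (A : N.Algorithm W Z T) (μ : Measure (∀ v, W v)) (t : Fin T)
    (e : N.edges) (b : N.Y e) : 0 ≤ A.outputLaw μ t e b :=
  Finset.sum_nonneg fun x _ => mul_nonneg (A.inputLaw_nonneg μ t e x) (N.K_nonneg e x b)

theorem sum_outputLaw (A : N.Algorithm W Z T) (μ : Measure (∀ v, W v)) [IsProbabilityMeasure μ]
    (t : Fin T) (e : N.edges) : ∑ b, A.outputLaw μ t e b = 1 := by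
  unfold outputLaw
  rw [Finset.sum_comm, ← A.sum_inputLaw μ t e]
  exact Finset.sum_congr rfl fun x _ => by rw [← Finset.mul_sum, N.K_sum, mul_one]

/-- The expected information density of a channel use is at most the capacity. -/
theorem sum_integral_likelihood_mul_logb_le (A : N.Algorithm W Z T) (μ : Measure (∀ v, W v))
    [IsProbabilityMeasure μ] (t : Fin T) (e : N.edges) :
    ENNReal.ofReal (∑ y, ∫ w, A.likelihood w y *
      Real.logb 2 (N.K e (A.input w y t e) (y t e) / A.outputLaw μ t e (y t e)) ∂μ) ≤
      capacity (N.K e) := by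
  rw [A.sum_integral_likelihood_mul μ t e fun x b =>
    Real.logb 2 (N.K e x b / A.outputLaw μ t e b)]
  -- The double sum is literally the mutual information for `inputLaw`, one of the competitors in
  -- the supremum.
  exact le_iSup₂_of_le (f := fun p (_ : p ∈ stdSimplex ℝ (N.X e)) =>
    ENNReal.ofReal (mutualInfo p (N.K e))) (A.inputLaw μ t e)
    ⟨A.inputLaw_nonneg μ t e, A.sum_inputLaw μ t e⟩ le_rfl

/-- Absolute continuity of the true law with respect to the reference law. It is what makes the
conventions `x / 0 = 0` and `log 0 = 0` harmless in the information density. -/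
theorem ae_likelihood_eq_zero (A : N.Algorithm W Z T) (μ : Measure (∀ v, W v))
    [IsFiniteMeasure μ] (y : Fin T → ∀ e, N.Y e) (t : Fin T) (e : N.edges)
    (h : A.outputLaw μ t e (y t e) = 0) : ∀ᵐ w ∂μ, A.likelihood w y = 0 := by
  classical
  have h1 := A.sum_integral_likelihood_mul μ t e fun _ b => if b = y t e then 1 else 0
  simp only [mul_ite, mul_one, mul_zero, Finset.sum_ite_eq', Finset.mem_univ, if_true] at h1
  rw [show ∑ x, A.inputLaw μ t e x * N.K e x (y t e) = 0 from h,
    Finset.sum_eq_zero_iff_of_nonneg] at h1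
  · have h2 := h1 y (Finset.mem_univ y)
    simp only [if_true] at h2
    rw [integral_eq_zero_iff_of_nonneg (fun w => A.likelihood_nonneg w y)] at h2
    · exact h2
    · simpa using A.integrable_likelihood_mul_comp μ y t e fun _ => 1
  · intro y' _
    refine integral_nonneg fun w => ?_
    dsimp only
    split_ifs
    · exact A.likelihood_nonneg w y'
    · exact le_rfl

end Algorithm
end Network

/-! ### Change of measure to the law with the cut channels replaced by noise -/

namespace Network.Algorithm

variable {V : Type*} {N : Network V} {W : V → Type*} [∀ v, MeasurableSpace (W v)]
  {Z : Type*} [MeasurableSpace Z] {T : ℕ} [DecidableEq V]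

/-- The conditional weight of `y` given `w` when the channels that enter `S` from outside are
replaced by independent noise of law `q`. -/
def refLikelihood (A : N.Algorithm W Z T) (S : Finset V) (q : Fin T → ∀ e, N.Y e → ℝ)
    (w : ∀ v, W v) (y : Fin T → ∀ e, N.Y e) : ℝ :=
  ∏ t, ∏ e : N.edges, if e.1.1 ∉ S ∧ e.1.2 ∈ S then q t e (y t e) else N.K e (A.input w y t e) (y t e)

variable {S : Finset V} {q : Fin T → ∀ e, N.Y e → ℝ}

theorem refLikelihood_nonneg (A : N.Algorithm W Z T) (hq : ∀ t e b, 0 ≤ q t e b)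
    (w : ∀ v, W v) (y : Fin T → ∀ e, N.Y e) : 0 ≤ A.refLikelihood S q w y :=
  Finset.prod_nonneg fun t _ => Finset.prod_nonneg fun e _ => by
    split_ifs
    exacts [hq _ _ _, N.K_nonneg _ _ _]

theorem refLikelihood_le_one (A : N.Algorithm W Z T) (hq : ∀ t e b, 0 ≤ q t e b)
    (hq1 : ∀ t e, ∑ b, q t e b = 1) (w : ∀ v, W v) (y : Fin T → ∀ e, N.Y e) :
    A.refLikelihood S q w y ≤ 1 := by
  have h0 : ∀ (t : Fin T) (e : N.edges), 0 ≤ if e.1.1 ∉ S ∧ e.1.2 ∈ S then q t e (y t e)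
      else N.K e (A.input w y t e) (y t e) := fun t e => by
    split_ifs
    exacts [hq _ _ _, N.K_nonneg _ _ _]
  refine Finset.prod_le_one (fun t _ => Finset.prod_nonneg fun e _ => h0 t e) fun t _ =>
    Finset.prod_le_one (fun e _ => h0 t e) fun e _ => ?_
  split_ifs
  · rw [← hq1 t e]
    exact Finset.single_le_sum (fun b _ => hq t e b) (Finset.mem_univ _)
  · exact N.K_le_one _ _ _

theorem measurable_refLikelihood (A : N.Algorithm W Z T) (y : Fin T → ∀ e, N.Y e) :
    Measurable fun w => A.refLikelihood S q w y :=
  Finset.measurable_prod _ fun t _ => Finset.measurable_prod _ fun e _ => by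
    split_ifs
    exacts [measurable_const, A.measurable_comp_input y t e fun x => N.K e x (y t e)]

/-- This is `log x ≤ x - 1` at `x = c * r / l`, multiplied by `l`, with `l` and `r` the true and the
reference likelihood. In `log (l / r)` all factors outside the cut cancel. The constant `c` is the
value of the test at the point considered. -/
theorem likelihood_mul_log_le (A : N.Algorithm W Z T) (hq : ∀ t e b, 0 ≤ q t e b) {c : ℝ}
    (hc : 0 < c) (w : ∀ v, W v) (y : Fin T → ∀ e, N.Y e)
    (h0 : ∀ t e, q t e (y t e) = 0 → A.likelihood w y = 0) :
    A.likelihood w y * Real.log c - ∑ t, ∑ e : N.edges with e.1.1 ∉ S ∧ e.1.2 ∈ S,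
      A.likelihood w y * Real.log (N.K e (A.input w y t e) (y t e) / q t e (y t e)) ≤
      c * A.refLikelihood S q w y - A.likelihood w y := by
  rcases (A.likelihood_nonneg w y).eq_or_lt with hl | hl
  · simp only [← hl, zero_mul, Finset.sum_const_zero, sub_zero]
    exact mul_nonneg hc.le (A.refLikelihood_nonneg hq w y)
  have hK : ∀ t e, 0 < N.K e (A.input w y t e) (y t e) := fun t e =>
    (N.K_nonneg _ _ _).lt_of_ne' (Finset.prod_ne_zero_iff.1
      (Finset.prod_ne_zero_iff.1 hl.ne' t (Finset.mem_univ t)) e (Finset.mem_univ e))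
  have hq' : ∀ t e, 0 < q t e (y t e) := fun t e =>
    (hq t e _).lt_of_ne' fun h => hl.ne' (h0 t e h)
  have hif : ∀ (t : Fin T) (e : N.edges), 0 < if e.1.1 ∉ S ∧ e.1.2 ∈ S then q t e (y t e)
      else N.K e (A.input w y t e) (y t e) := fun t e => by
    split_ifs
    exacts [hq' t e, hK t e]
  have hr : 0 < A.refLikelihood S q w y :=
    Finset.prod_pos fun t _ => Finset.prod_pos fun e _ => hif t e
  have hlog : Real.log (A.likelihood w y) - Real.log (A.refLikelihood S q w y) =
      ∑ t, ∑ e : N.edges with e.1.1 ∉ S ∧ e.1.2 ∈ S,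
        Real.log (N.K e (A.input w y t e) (y t e) / q t e (y t e)) := by
    unfold likelihood refLikelihood
    rw [Real.log_prod fun t _ => (Finset.prod_pos fun e _ => hK t e).ne',
      Real.log_prod fun t _ => (Finset.prod_pos fun e _ => hif t e).ne', ← Finset.sum_sub_distrib]
    refine Finset.sum_congr rfl fun t _ => ?_
    rw [Real.log_prod fun e _ => (hK t e).ne', Real.log_prod fun e _ => (hif t e).ne',
      ← Finset.sum_sub_distrib, Finset.sum_filter]
    refine Finset.sum_congr rfl fun e _ => ?_
    split_ifs
    · rw [Real.log_div (hK t e).ne' (hq' t e).ne']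
    · exact sub_self _
  simp_rw [← Finset.mul_sum]
  rw [← hlog]
  have h1 := Real.log_le_sub_one_of_pos (div_pos (mul_pos hc hr) hl)
  rw [Real.log_div (mul_pos hc hr).ne' hl.ne', Real.log_mul hc.ne' hr.ne'] at h1
  have h2 := mul_le_mul_of_nonneg_left h1 hl.le
  rw [mul_sub _ (_ / _), mul_div_cancel₀ _ hl.ne'] at h2
  linarith

/-- A change of measure: the divergence of the law of an algorithm from the law where the channels
into `S` are cut dominates the expected logarithm of any two-valued test. -/
theorem change_of_measure (A : N.Algorithm W Z T) (μ : Measure (∀ v, W v))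
    [IsProbabilityMeasure μ] (S : Finset V) (G : (Fin T → ∀ e, N.Y e) → Set (∀ v, W v))
    (hG : ∀ y, MeasurableSet (G y)) {α β : ℝ} (hα : 0 < α) (hβ : 0 < β) :
    (∑ y, ∫ w, A.likelihood w y * (G y).indicator 1 w ∂μ) * Real.log α +
      (1 - ∑ y, ∫ w, A.likelihood w y * (G y).indicator 1 w ∂μ) * Real.log β -
      ∑ t, ∑ e : N.edges with e.1.1 ∉ S ∧ e.1.2 ∈ S, ∑ y, ∫ w, A.likelihood w y *
        Real.log (N.K e (A.input w y t e) (y t e) / A.outputLaw μ t e (y t e)) ∂μ ≤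
    α * (∑ y, ∫ w, A.refLikelihood S (A.outputLaw μ) w y * (G y).indicator 1 w ∂μ) +
      β * (∑ y, ∫ w, A.refLikelihood S (A.outputLaw μ) w y ∂μ) - 1 := by
  set q := A.outputLaw μ
  have hq : ∀ t e b, 0 ≤ q t e b := A.outputLaw_nonneg μ
  have hq1 : ∀ t e, ∑ b, q t e b = 1 := A.sum_outputLaw μ
  have mI : ∀ y, Measurable ((G y).indicator (1 : (∀ v, W v) → ℝ)) := fun y =>
    measurable_one.indicator (hG y)
  have bI : ∀ y w, |(G y).indicator (1 : (∀ v, W v) → ℝ) w| ≤ 1 := fun y w => by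
    by_cases h : w ∈ G y <;> simp [h]
  have iL : ∀ y, Integrable (fun w => A.likelihood w y) μ := fun y => by
    simpa using A.integrable_likelihood_mul μ y (F := fun _ => 1) measurable_const (C := 1) (by simp)
  have iLG : ∀ y, Integrable (fun w => A.likelihood w y * (G y).indicator 1 w) μ := fun y =>
    A.integrable_likelihood_mul μ y (mI y) (bI y)
  have iR : ∀ y, Integrable (fun w => A.refLikelihood S q w y) μ := fun y =>
    Integrable.of_bound (A.measurable_refLikelihood y).aestronglyMeasurable 1
      (.of_forall fun w => by
        rw [Real.norm_of_nonneg (A.refLikelihood_nonneg hq w y)]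
        exact A.refLikelihood_le_one hq hq1 w y)
  have iRG : ∀ y, Integrable (fun w => A.refLikelihood S q w y * (G y).indicator 1 w) μ := fun y =>
    Integrable.of_bound ((A.measurable_refLikelihood y).mul (mI y)).aestronglyMeasurable 1
      (.of_forall fun w => by
        rw [norm_mul, Real.norm_of_nonneg (A.refLikelihood_nonneg hq w y)]
        exact mul_le_one₀ (A.refLikelihood_le_one hq hq1 w y) (norm_nonneg _) (bI y w))
  have iK : ∀ y t e, Integrable (fun w => A.likelihood w y *
      Real.log (N.K e (A.input w y t e) (y t e) / q t e (y t e))) μ := fun y t e =>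
    A.integrable_likelihood_mul_comp μ y t e fun x => Real.log (N.K e x (y t e) / q t e (y t e))
  have h1 : ∑ y, ∫ w, A.likelihood w y ∂μ = 1 := by
    rw [← integral_finsetSum _ fun y _ => iL y]
    simp [sum_likelihood]
  have key : ∀ y, (∫ w, A.likelihood w y * (G y).indicator 1 w ∂μ) * (Real.log α - Real.log β) +
      (∫ w, A.likelihood w y ∂μ) * Real.log β -
      ∑ t, ∑ e : N.edges with e.1.1 ∉ S ∧ e.1.2 ∈ S, ∫ w, A.likelihood w y *
        Real.log (N.K e (A.input w y t e) (y t e) / q t e (y t e)) ∂μ ≤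
      α * (∫ w, A.refLikelihood S q w y * (G y).indicator 1 w ∂μ) +
      β * (∫ w, A.refLikelihood S q w y ∂μ) - ∫ w, A.likelihood w y ∂μ := fun y => by
    have iS : Integrable (fun w => ∑ t, ∑ e : N.edges with e.1.1 ∉ S ∧ e.1.2 ∈ S,
        A.likelihood w y * Real.log (N.K e (A.input w y t e) (y t e) / q t e (y t e))) μ :=
      integrable_finsetSum _ fun t _ => integrable_finsetSum _ fun e _ => iK y t e
    have e1 : ∑ t, ∑ e : N.edges with e.1.1 ∉ S ∧ e.1.2 ∈ S, ∫ w, A.likelihood w y *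
        Real.log (N.K e (A.input w y t e) (y t e) / q t e (y t e)) ∂μ =
        ∫ w, ∑ t, ∑ e : N.edges with e.1.1 ∉ S ∧ e.1.2 ∈ S, A.likelihood w y *
        Real.log (N.K e (A.input w y t e) (y t e) / q t e (y t e)) ∂μ := by
      rw [integral_finsetSum _ fun t _ => integrable_finsetSum _ fun e _ => iK y t e]
      exact Finset.sum_congr rfl fun t _ => (integral_finsetSum _ fun e _ => iK y t e).symm
    have iA : Integrable (fun w => A.likelihood w y * (G y).indicator 1 w *
        (Real.log α - Real.log β) + A.likelihood w y * Real.log β) μ :=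
      ((iLG y).mul_const _).add ((iL y).mul_const _)
    have iB : Integrable (fun w => α * (A.refLikelihood S q w y * (G y).indicator 1 w) +
        β * A.refLikelihood S q w y) μ := ((iRG y).const_mul _).add ((iR y).const_mul _)
    rw [e1, ← integral_mul_const, ← integral_mul_const, ← integral_const_mul, ← integral_const_mul,
      ← integral_add ((iLG y).mul_const _) ((iL y).mul_const _), ← integral_sub iA iS,
      ← integral_add ((iRG y).const_mul _) ((iR y).const_mul _), ← integral_sub iB (iL y)]
    refine integral_mono_ae (iA.sub iS) (iB.sub (iL y)) ?_
    have hae : ∀ᵐ w ∂μ, ∀ t e, q t e (y t e) = 0 → A.likelihood w y = 0 := by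
      simp only [ae_all_iff]
      exact fun t e h => A.ae_likelihood_eq_zero μ y t e h
    filter_upwards [hae] with w hw
    have hr := A.refLikelihood_nonneg (S := S) hq w y
    by_cases hwG : w ∈ G y
    -- On the event the test equals `α`. The term with `β` on the right is superfluous here but
    -- nonnegative; keeping it lets `β` multiply the total reference mass.
    · have := A.likelihood_mul_log_le (S := S) hq hα w y hw
      simp only [hwG, Set.indicator_of_mem, Pi.one_apply]
      nlinarith
    · have := A.likelihood_mul_log_le (S := S) hq hβ w y hw
      simp only [hwG, Set.indicator_of_notMem, not_false_eq_true]
      linarith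
  have hsum := Finset.sum_le_sum fun y (_ : y ∈ Finset.univ) => key y
  simp only [Finset.sum_sub_distrib, Finset.sum_add_distrib, ← Finset.mul_sum, ← Finset.sum_mul,
    h1] at hsum
  rw [Finset.sum_comm] at hsum
  simp only [Finset.sum_comm (s := (Finset.univ : Finset (Fin T → ∀ e, N.Y e)))] at hsum
  linarith

end Network.Algorithm

/-! ### The reference law as seen from inside the cut -/

namespace Network.Algorithm

variable {V : Type*} {N : Network V} {W : V → Type*} [∀ v, MeasurableSpace (W v)]
  {Z : Type*} [MeasurableSpace Z] {T : ℕ}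

/-- The symbol sent along an edge that leaves `S`, as a function of the data available in `S`. -/
def localInput (A : N.Algorithm W Z T) {S : Finset V} (w : ∀ v : S, W v) (t : Fin T)
    (h : Fin t → ∀ e : {e : N.edges // e.1.2 ∈ S}, N.Y e.1) (e : N.edges) (he : e.1.1 ∈ S) :
    N.X e :=
  A.enc e.1.1 t (w ⟨e.1.1, he⟩)
    (fun s e' => h s ⟨e'.1, (congrArg (· ∈ S) e'.2).mpr he⟩) ⟨e, rfl⟩

variable [DecidableEq V]

/-- The law of the symbols received in `S` at one time, when the channels that enter `S` from
outside are replaced by independent noise of law `q`. -/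
def localKernel (A : N.Algorithm W Z T) {S : Finset V} (q : Fin T → ∀ e, N.Y e → ℝ)
    (w : ∀ v : S, W v) (t : Fin T) (h : Fin t → ∀ e : {e : N.edges // e.1.2 ∈ S}, N.Y e.1)
    (b : ∀ e : {e : N.edges // e.1.2 ∈ S}, N.Y e.1) : ℝ :=
  ∏ e : {e : N.edges // e.1.2 ∈ S}, if he : e.1.1.1 ∈ S then
    N.K e.1 (A.localInput w t h e.1 he) (b e) else q t e.1 (b e)

variable {S : Finset V} {q : Fin T → ∀ e, N.Y e → ℝ}

theorem localKernel_nonneg (A : N.Algorithm W Z T) (hq : ∀ t e b, 0 ≤ q t e b)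
    (w : ∀ v : S, W v) (t : Fin T) (h : Fin t → ∀ e : {e : N.edges // e.1.2 ∈ S}, N.Y e.1)
    (b : ∀ e : {e : N.edges // e.1.2 ∈ S}, N.Y e.1) : 0 ≤ A.localKernel q w t h b :=
  Finset.prod_nonneg fun e _ => by
    split_ifs
    exacts [N.K_nonneg _ _ _, hq _ _ _]

theorem sum_localKernel (A : N.Algorithm W Z T) (hq1 : ∀ t e, ∑ b, q t e b = 1)
    (w : ∀ v : S, W v) (t : Fin T) (h : Fin t → ∀ e : {e : N.edges // e.1.2 ∈ S}, N.Y e.1) :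
    ∑ b, A.localKernel q w t h b = 1 := by
  unfold localKernel
  rw [← Fintype.prod_sum (fun (e : {e : N.edges // e.1.2 ∈ S}) (b : N.Y e.1) =>
    if he : e.1.1.1 ∈ S then N.K e.1 (A.localInput w t h e.1 he) b else q t e.1 b)]
  refine Finset.prod_eq_one fun e _ => ?_
  split_ifs
  exacts [N.K_sum _ _, hq1 _ _]

theorem measurable_localKernel (A : N.Algorithm W Z T) (t : Fin T)
    (h : Fin t → ∀ e : {e : N.edges // e.1.2 ∈ S}, N.Y e.1)
    (b : ∀ e : {e : N.edges // e.1.2 ∈ S}, N.Y e.1) :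
    Measurable fun w => A.localKernel q w t h b :=
  Finset.measurable_prod _ fun e _ => by
    split_ifs with he
    · refine (measurable_from_top (f := fun x => N.K e.1 x (b e))).comp ?_
      exact (measurable_pi_apply (⟨e.1, rfl⟩ : N.Out e.1.1.1)).comp
        ((A.measurable_enc e.1.1.1 t _).comp (measurable_pi_apply (⟨e.1.1.1, he⟩ : S)))
    · exact measurable_const

/-- The trajectories of all symbols are the pairs of a trajectory of the symbols received in `S`
and one of the symbols received outside `S`. -/
theorem sum_split (S : Finset V) (F : (Fin T → ∀ e, N.Y e) → ℝ) :
    ∑ y, F y = ∑ yS : Fin T → ∀ e : {e : N.edges // e.1.2 ∈ S}, N.Y e.1,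
      ∑ yR : Fin T → ∀ e : {e : N.edges // ¬ e.1.2 ∈ S}, N.Y e.1,
        F fun t => (Equiv.piEquivPiSubtypeProd (fun e : N.edges => e.1.2 ∈ S) N.Y).symm
          (yS t, yR t) := by
  rw [← (((Equiv.piCongrRight fun _ : Fin T => Equiv.piEquivPiSubtypeProd
    (fun e : N.edges => e.1.2 ∈ S) N.Y).trans
      (Equiv.arrowProdEquivProdArrow (Fin T) _ _)).symm).sum_comp, Fintype.sum_prod_type]
  rfl

/-- Under the reference law the symbols received in `S` depend on the observations in `S` only. -/
theorem sum_refLikelihood_mul (A : N.Algorithm W Z T) (w : ∀ v, W v)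
    (g : (Fin T → ∀ e : {e : N.edges // e.1.2 ∈ S}, N.Y e.1) → ℝ) :
    ∑ y, A.refLikelihood S q w y * g (fun t e => y t e.1) =
      ∑ yS, causalWeight (A.localKernel q fun v : S => w v) yS * g yS := by
  rw [sum_split S]
  refine Finset.sum_congr rfl fun yS _ => ?_
  set c := (Equiv.piEquivPiSubtypeProd (fun e : N.edges => e.1.2 ∈ S) N.Y).symm
  have hc : ∀ p (e : {e : N.edges // e.1.2 ∈ S}), c p e.1 = p.1 e := fun p e => dif_pos e.2
  have hc' : ∀ p (e : {e : N.edges // ¬ e.1.2 ∈ S}), c p e.1 = p.2 e := fun p e => dif_neg e.2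
  -- With the symbols received in `S` frozen, those received outside `S` still evolve by a
  -- stochastic causal kernel, so their weights sum to one.
  have hR := sum_causalWeight (fun (t : Fin T)
    (h : Fin t → ∀ e : {e : N.edges // ¬ e.1.2 ∈ S}, N.Y e.1)
    (b : ∀ e : {e : N.edges // ¬ e.1.2 ∈ S}, N.Y e.1) =>
      ∏ e, N.K e.1 (A.encInput w t (fun s => c (yS (Fin.castLE t.is_lt.le s), h s)) e.1) (b e))
    fun t h => by
      rw [← Fintype.prod_sum (fun (e : {e : N.edges // ¬ e.1.2 ∈ S}) (b : N.Y e.1) =>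
        N.K e.1 (A.encInput w t (fun s => c (yS (Fin.castLE t.is_lt.le s), h s)) e.1) b)]
      exact Finset.prod_eq_one fun e _ => N.K_sum _ _
  rw [← mul_one (causalWeight _ yS * g yS), ← hR, Finset.mul_sum]
  refine Finset.sum_congr rfl fun yR _ => ?_
  have hg : (fun (t : Fin T) (e : {e : N.edges // e.1.2 ∈ S}) => c (yS t, yR t) e.1) = yS :=
    funext fun t => funext fun e => hc _ e
  rw [hg, mul_right_comm]
  congr 1
  unfold refLikelihood causalWeight
  rw [← Finset.prod_mul_distrib]
  refine Finset.prod_congr rfl fun t _ => ?_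
  -- Edges ending in `S` give the local kernel. Edges ending outside `S` are never in the cut and
  -- give the kernel summed away in `hR`.
  rw [← Fintype.prod_subtype_mul_prod_subtype (fun e : N.edges => e.1.2 ∈ S)]
  congr 1
  · unfold localKernel
    refine Finset.prod_congr rfl fun e _ => ?_
    by_cases he : e.1.1.1 ∈ S
    · rw [if_neg (fun h => h.1 he), dif_pos he]; dsimp only; rw [hc]
      congr 1
      unfold input localInput
      congr 1
      funext s e'
      exact hc _ ⟨e'.1, (congrArg (· ∈ S) e'.2).mpr he⟩
    · rw [if_pos ⟨he, e.2⟩, dif_neg he]; dsimp only; rw [hc]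
  · refine Finset.prod_congr rfl fun e _ => ?_
    rw [if_neg (fun h => e.2 h.2)]; dsimp only; rw [hc']
    rfl

end Network.Algorithm

/-! ### Small-ball estimate for the Gaussian sum -/

/-- An interval of length `2 ε` has small Gaussian measure. -/
theorem gaussianReal_real_abs_sub_le (m : ℝ) {v : NNReal} (hv : v ≠ 0) (c : ℝ) {ε : ℝ}
    (hε : 0 ≤ ε) :
    (gaussianReal m v).real {x | |c - x| ≤ ε} ≤ 2 * ε / Real.sqrt (2 * Real.pi * v) := by
  have hs : {x : ℝ | |c - x| ≤ ε} = Metric.closedBall c ε := by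
    ext x
    rw [Metric.mem_closedBall', Real.dist_eq, Set.mem_ofPred_eq]
  refine ENNReal.toReal_le_of_le_ofReal (by positivity) ?_
  rw [hs, gaussianReal_apply m hv]
  calc ∫⁻ x in Metric.closedBall c ε, gaussianPDF m v x
      ≤ ∫⁻ _ in Metric.closedBall c ε, ENNReal.ofReal (Real.sqrt (2 * Real.pi * v))⁻¹ := by
        refine lintegral_mono fun x => ENNReal.ofReal_le_ofReal ?_
        rw [gaussianPDFReal]
        refine mul_le_of_le_one_right (by positivity) (Real.exp_le_one_iff.2 ?_)
        exact div_nonpos_of_nonpos_of_nonneg (neg_nonpos.2 (sq_nonneg _)) (by positivity)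
    _ = ENNReal.ofReal (2 * ε / Real.sqrt (2 * Real.pi * v)) := by
        rw [setLIntegral_const, Real.volume_closedBall, ← ENNReal.ofReal_mul (by positivity)]
        congr 1
        ring

variable {V : Type*} [Fintype V] [DecidableEq V]

/-- Variances of independent Gaussians add, one coordinate at a time. -/
theorem map_sum_mul_pi_gaussianReal (a : V → ℝ) (s : Finset V) :
    (Measure.pi fun _ : V => gaussianReal 0 1).map (fun w => ∑ v ∈ s, a v * w v) =
      gaussianReal 0 (∑ v ∈ s, Real.toNNReal (a v ^ 2)) := by
  have hind : iIndepFun (fun (v : V) (w : V → ℝ) => a v * w v)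
      (Measure.pi fun _ : V => gaussianReal 0 1) :=
    iIndepFun_pi (X := fun v x => a v * x) fun v => (measurable_const_mul (a v)).aemeasurable
  have hm : ∀ v, Measurable fun w : V → ℝ => a v * w v := fun v =>
    (measurable_const_mul (a v)).comp (measurable_pi_apply v)
  induction s using Finset.induction_on with
  | empty => simp
  | insert v s hv ih =>
    have h1 : (Measure.pi fun _ : V => gaussianReal 0 1).map (fun w => a v * w v) =
        gaussianReal 0 (Real.toNNReal (a v ^ 2)) := by
      have hc : (Measure.pi fun _ : V => gaussianReal 0 1).map (fun w => a v * w v) =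
          ((Measure.pi fun _ : V => gaussianReal 0 1).map (Function.eval v)).map (a v * ·) :=
        (Measure.map_map (measurable_const_mul (a v)) (measurable_pi_apply v)).symm
      rw [hc, (measurePreserving_eval (fun _ : V => gaussianReal 0 1) v).map_eq,
        gaussianReal_map_const_mul]
      congr 1
      · simp
      · rw [mul_one, Real.toNNReal_of_nonneg (sq_nonneg _)]
    have h2 : ∑ j ∈ s, (fun w : V → ℝ => a j * w j) = fun w => ∑ v ∈ s, a v * w v := by
      ext w
      simp
    have h3 := gaussianReal_add_gaussianReal_of_indepFun
      (hind.indepFun_finsetSum_of_notMem hm hv).symm h1 (by rw [h2]; exact ih)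
    rw [h2, add_zero] at h3
    rw [Finset.sum_insert hv, ← h3]
    congr 1
    ext w
    simp [Finset.sum_insert hv]

/-- Conditionally on the observations in `S`, a guess based on them rarely comes close to the
weighted sum of all observations. -/
theorem integral_mul_indicator_abs_sub_le (a : V → ℝ) (S : Finset V)
    (ha : 0 < ∑ v ∈ Sᶜ, a v ^ 2) {ε : ℝ} (hε : 0 ≤ ε) {h z : (S → ℝ) → ℝ} (hm : Measurable h)
    (hz : Measurable z) (h0 : ∀ x, 0 ≤ h x) (h1 : ∀ x, h x ≤ 1) :
    ∫ w, h (fun v : S => w v) * {w : V → ℝ | |∑ v, a v * w v - z fun v : S => w v| ≤ ε}.indicator 1 w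
      ∂(Measure.pi fun _ : V => gaussianReal 0 1) ≤
    2 * ε / Real.sqrt (2 * Real.pi * ∑ v ∈ Sᶜ, a v ^ 2) *
      ∫ w, h (fun v : S => w v) ∂(Measure.pi fun _ : V => gaussianReal 0 1) := by
  set μ : Measure (V → ℝ) := Measure.pi fun _ => gaussianReal 0 1
  set L := 2 * ε / Real.sqrt (2 * Real.pi * ∑ v ∈ Sᶜ, a v ^ 2)
  let X : (V → ℝ) → S → ℝ := fun w v => w v
  let R : (V → ℝ) → ℝ := fun w => ∑ v ∈ Sᶜ, a v * w v
  have hX : Measurable X := measurable_pi_lambda _ fun v => measurable_pi_apply _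
  have hR : Measurable R :=
    Finset.measurable_sum _ fun v _ => (measurable_const_mul (a v)).comp (measurable_pi_apply v)
  have hind : IndepFun X R μ := by
    have hi : iIndepFun (fun (v : V) (w : V → ℝ) => w v) μ :=
      iIndepFun_pi (X := fun _ x => x) fun v => aemeasurable_id
    have := (hi.indepFun_finset S Sᶜ disjoint_compl_right fun v => measurable_pi_apply v).comp
      (φ := id) (ψ := fun x : (Sᶜ : Finset V) → ℝ =>
        ∑ v : (Sᶜ : Finset V), a v * x v) measurable_id (Finset.measurable_sum _ fun v _ =>
          (measurable_const_mul (a v)).comp (measurable_pi_apply v))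
    have hRe : R = (fun x : (Sᶜ : Finset V) → ℝ => ∑ v : (Sᶜ : Finset V), a v * x v) ∘
        fun w v => w v := funext fun w => (Finset.sum_coe_sort Sᶜ fun v => a v * w v).symm
    rw [hRe]
    exact this
  have hν : μ.map R = gaussianReal 0 (∑ v ∈ Sᶜ, Real.toNNReal (a v ^ 2)) :=
    map_sum_mul_pi_gaussianReal a Sᶜ
  have hvar : ((∑ v ∈ Sᶜ, Real.toNNReal (a v ^ 2) : NNReal) : ℝ) = ∑ v ∈ Sᶜ, a v ^ 2 := by
    push_cast
    exact Finset.sum_congr rfl fun v _ => Real.coe_toNNReal _ (sq_nonneg _)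
  have hvar0 : (∑ v ∈ Sᶜ, Real.toNNReal (a v ^ 2) : NNReal) ≠ 0 := fun h => by
    rw [h] at hvar
    exact ha.ne (by simpa using hvar)
  have hprod : μ.map (fun w => (X w, R w)) = (μ.map X).prod (μ.map R) :=
    (indepFun_iff_map_prod_eq_prod_map_map hX.aemeasurable hR.aemeasurable).1 hind
  have : IsProbabilityMeasure (μ.map X) := Measure.isProbabilityMeasure_map hX.aemeasurable
  have : IsProbabilityMeasure (μ.map R) := Measure.isProbabilityMeasure_map hR.aemeasurable
  -- In the independent coordinates `(X, R)` the error is, up to sign, a function of `X` minus `R`.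
  let B : Set ((S → ℝ) × ℝ) := {p | |(z p.1 - ∑ v : S, a v * p.1 v) - p.2| ≤ ε}
  have hB : MeasurableSet B := by
    refine measurableSet_le (continuous_abs.measurable.comp ?_) measurable_const
    refine ((hz.comp measurable_fst).sub (Finset.measurable_sum _ fun v _ => ?_)).sub measurable_snd
    exact ((measurable_pi_apply v).comp measurable_fst).const_mul _
  have hφm : Measurable fun p : (S → ℝ) × ℝ => h p.1 * B.indicator (1 : (S → ℝ) × ℝ → ℝ) p :=
    (hm.comp measurable_fst).mul (measurable_one.indicator hB)
  have hφi : Integrable (fun p : (S → ℝ) × ℝ => h p.1 * B.indicator (1 : (S → ℝ) × ℝ → ℝ) p)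
      ((μ.map X).prod (μ.map R)) := by
    refine Integrable.of_bound hφm.aestronglyMeasurable 1 (.of_forall fun p => ?_)
    rw [norm_mul, Real.norm_of_nonneg (h0 _)]
    refine mul_le_one₀ (h1 _) (norm_nonneg _) ?_
    by_cases hp : p ∈ B <;> simp [hp]
  have hhi : Integrable h (μ.map X) :=
    Integrable.of_bound hm.aestronglyMeasurable 1 (.of_forall fun x => by
      rw [Real.norm_of_nonneg (h0 _)]; exact h1 x)
  have e1 : ∫ w, h (fun v : S => w v) *
      {w : V → ℝ | |∑ v, a v * w v - z fun v : S => w v| ≤ ε}.indicator 1 w ∂μ =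
      ∫ p, h p.1 * B.indicator (1 : (S → ℝ) × ℝ → ℝ) p ∂(μ.map X).prod (μ.map R) := by
    rw [← hprod, integral_map (hX.prodMk hR).aemeasurable hφm.aestronglyMeasurable]
    refine integral_congr_ae (.of_forall fun w => ?_)
    change h (X w) * _ = h (X w) * _
    congr 1
    have hiff : ∀ w, |∑ v, a v * w v - z (X w)| ≤ ε ↔ (X w, R w) ∈ B := fun w => by
      change _ ↔ |(z (X w) - ∑ v : S, a v * w v) - ∑ v ∈ Sᶜ, a v * w v| ≤ ε
      rw [Finset.sum_coe_sort S fun v => a v * w v, sub_sub, Finset.sum_add_sum_compl, abs_sub_comm]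
    rw [show {w : V → ℝ | |∑ v, a v * w v - z fun v : S => w v| ≤ ε} =
      (fun w => (X w, R w)) ⁻¹' B from Set.ext hiff]
    rfl
  have e2 : ∫ w, h (fun v : S => w v) ∂μ = ∫ x, h x ∂μ.map X :=
    (integral_map hX.aemeasurable hm.aestronglyMeasurable).symm
  rw [e1, e2, integral_prod _ hφi, ← integral_const_mul]
  -- For fixed `x` the section of `B` is an interval of length `2ε`, and `R` is Gaussian.
  refine integral_mono hφi.integral_prod_left (hhi.const_mul L) fun x => ?_
  change ∫ r, h x * B.indicator 1 (x, r) ∂μ.map R ≤ L * h x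
  rw [integral_const_mul, mul_comm L]
  refine mul_le_mul_of_nonneg_left ?_ (h0 x)
  have hsec : (fun r => B.indicator (1 : (S → ℝ) × ℝ → ℝ) (x, r)) =
      (Prod.mk x ⁻¹' B).indicator 1 := rfl
  have hle := gaussianReal_real_abs_sub_le 0 hvar0 (z x - ∑ v : S, a v * x v) hε
  rw [hsec, integral_indicator_one (measurable_prodMk_left hB), hν]
  rw [hvar] at hle
  exact hle

/-! ### Optimizing the two-valued test -/

/-- The binary data-processing step: a test with two values is optimized. -/
theorem binary_divergence_le {p δ L I : ℝ} (hδ : 0 ≤ δ) (hδ' : δ < 1) (hp : 1 - δ ≤ p)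
    (hL : 0 < L) (hδL : δ * L ≤ 1 - δ)
    (H : ∀ α β, 0 < α → 0 < β →
      p * Real.log α + (1 - p) * Real.log β - I ≤ α * L + β - 1) :
    (1 - δ) * -Real.log L + (1 - δ) * Real.log (1 - δ) + δ * Real.log δ ≤ I := by
  have h1 : 0 < 1 - δ := by linarith
  -- The choice `α = (1 - δ) / L` turns the right side of `H` into `β - δ`. The natural `β` is `δ`,
  -- but `β` stays free because `δ` may vanish. The condition `β * L ≤ 1 - δ` means `β ≤ α`, so the
  -- left side of `H` increases with `p` and `p` may be replaced by `1 - δ`.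
  have key : ∀ β, 0 < β → β * L ≤ 1 - δ →
      (1 - δ) * (Real.log (1 - δ) - Real.log L) + δ * Real.log β - I ≤ β - δ := fun β hβ hβL => by
    have hα : β ≤ (1 - δ) / L := (le_div_iff₀ hL).2 hβL
    have h2 := H ((1 - δ) / L) β (by positivity) hβ
    have h3 := mul_nonneg (sub_nonneg.2 hp) (sub_nonneg.2 (Real.log_le_log hβ hα))
    rw [div_mul_cancel₀ _ hL.ne'] at h2
    rw [← Real.log_div h1.ne' hL.ne']
    linarith
  rcases hδ.eq_or_lt with rfl | hpos
  · simp only [sub_zero, Real.log_one, zero_mul, add_zero, zero_sub, one_mul, mul_zero] at key ⊢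
    refine le_of_forall_pos_le_add fun η hη => ?_
    -- For `δ = 0` let `β` tend to zero: `η` bounds the error, and `L⁻¹` ensures `β ≤ α`.
    have := key (min η L⁻¹) (by positivity) (by
      rw [← inv_mul_cancel₀ hL.ne']
      exact mul_le_mul_of_nonneg_right (min_le_right _ _) hL.le)
    linarith [min_le_left η L⁻¹]
  · linarith [key δ hpos hδL]

/-! ### The cutset bound for one algorithm -/

namespace Network.Algorithm

variable {V : Type*} {N : Network V} {W : V → Type*} [∀ v, MeasurableSpace (W v)]
  {Z : Type*} [MeasurableSpace Z] {T : ℕ} [DecidableEq V]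

/-- Only this inequality is needed, and it holds for sums and images of measures on arbitrary sets;
hence measurable sections of `B` suffice. -/
theorem ofReal_sum_integral_likelihood_le_jointLaw (A : N.Algorithm W Z T)
    (μ : Measure (∀ v, W v)) [IsProbabilityMeasure μ]
    (B : Set ((∀ v, W v) × (Fin T → ∀ e, N.Y e))) (hB : ∀ y, MeasurableSet {w | (w, y) ∈ B}) :
    ENNReal.ofReal (∑ y, ∫ w, A.likelihood w y * {w | (w, y) ∈ B}.indicator 1 w ∂μ) ≤
      A.jointLaw μ B := by
  have h0 : ∀ y w, 0 ≤ A.likelihood w y * {w | (w, y) ∈ B}.indicator 1 w := fun y w =>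
    mul_nonneg (A.likelihood_nonneg w y) (Set.indicator_nonneg (fun _ _ => zero_le_one) w)
  rw [ENNReal.ofReal_sum_of_nonneg fun y _ => integral_nonneg (h0 y)]
  refine le_trans ?_ (Measure.le_sum_apply _ _)
  rw [tsum_fintype]
  refine Finset.sum_le_sum fun y _ => ?_
  refine le_trans ?_ (Measure.le_map_apply measurable_prodMk_right.aemeasurable _)
  change _ ≤ (μ.withDensity fun w =>
    ∏ t, ∏ e, ENNReal.ofReal (N.K e (A.input w y t e) (y t e))) {w | (w, y) ∈ B}
  rw [withDensity_apply _ (hB y), ← lintegral_indicator (hB y),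
    ofReal_integral_eq_lintegral_ofReal _ (.of_forall (h0 y))]
  · refine lintegral_mono fun w => ?_
    by_cases hw : w ∈ {w | (w, y) ∈ B}
    · rw [Set.indicator_of_mem hw, Set.indicator_of_mem hw, Pi.one_apply, mul_one, likelihood,
        ENNReal.ofReal_prod_of_nonneg fun _ _ => Finset.prod_nonneg fun _ _ => N.K_nonneg _ _ _]
      refine (Finset.prod_congr rfl fun t _ => ?_).le
      exact ENNReal.ofReal_prod_of_nonneg fun _ _ => N.K_nonneg _ _ _
    · simp [Set.indicator_of_notMem hw]
  · refine A.integrable_likelihood_mul μ y (measurable_one.indicator (hB y)) (C := 1) fun w => ?_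
    by_cases hw : w ∈ {w | (w, y) ∈ B} <;> simp [hw]

/-- The information that flows into `S` during `T` steps is at most `T` times the cutset capacity. -/
theorem ofReal_sum_information_le (A : N.Algorithm W Z T) (μ : Measure (∀ v, W v))
    [IsProbabilityMeasure μ] (S : Finset V) :
    ENNReal.ofReal ((∑ t, ∑ e : N.edges with e.1.1 ∉ S ∧ e.1.2 ∈ S, ∑ y, ∫ w, A.likelihood w y *
      Real.log (N.K e (A.input w y t e) (y t e) / A.outputLaw μ t e (y t e)) ∂μ) / Real.log 2) ≤
      T * N.cutsetCapacity S := by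
  have h : (∑ t, ∑ e : N.edges with e.1.1 ∉ S ∧ e.1.2 ∈ S, ∑ y, ∫ w, A.likelihood w y *
      Real.log (N.K e (A.input w y t e) (y t e) / A.outputLaw μ t e (y t e)) ∂μ) / Real.log 2 =
      ∑ t, ∑ e : N.edges with e.1.1 ∉ S ∧ e.1.2 ∈ S, ∑ y, ∫ w, A.likelihood w y *
      Real.logb 2 (N.K e (A.input w y t e) (y t e) / A.outputLaw μ t e (y t e)) ∂μ := by
    simp only [Finset.sum_div, ← integral_div, Real.logb, mul_div_assoc]
  have hsub : ∀ {ι : Type _} (s : Finset ι) (g : ι → ℝ),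
      ENNReal.ofReal (∑ i ∈ s, g i) ≤ ∑ i ∈ s, ENNReal.ofReal (g i) := fun s g =>
    Finset.le_sum_of_subadditive _ ENNReal.ofReal_zero.le (fun _ _ => ENNReal.ofReal_add_le) s g
  rw [h]
  calc _ ≤ ∑ _t : Fin T, N.cutsetCapacity S := (hsub _ _).trans <| Finset.sum_le_sum fun t _ =>
        (Finset.le_sum_of_subadditive _ ENNReal.ofReal_zero.le
          (fun _ _ => ENNReal.ofReal_add_le) _ _).trans <| Finset.sum_le_sum fun e _ =>
          A.sum_integral_likelihood_mul_logb_le μ t e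
    _ = T * N.cutsetCapacity S := by simp

section Reference

variable {S : Finset V} {q : Fin T → ∀ e, N.Y e → ℝ}

theorem causalWeight_localKernel_nonneg (A : N.Algorithm W Z T) (hq : ∀ t e b, 0 ≤ q t e b)
    (w : ∀ v : S, W v) (y : Fin T → ∀ e : {e : N.edges // e.1.2 ∈ S}, N.Y e.1) :
    0 ≤ causalWeight (A.localKernel q w) y :=
  Finset.prod_nonneg fun _ _ => A.localKernel_nonneg hq _ _ _ _

theorem causalWeight_localKernel_le_one (A : N.Algorithm W Z T) (hq : ∀ t e b, 0 ≤ q t e b)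
    (hq1 : ∀ t e, ∑ b, q t e b = 1) (w : ∀ v : S, W v)
    (y : Fin T → ∀ e : {e : N.edges // e.1.2 ∈ S}, N.Y e.1) :
    causalWeight (A.localKernel q w) y ≤ 1 := by
  rw [← sum_causalWeight _ (A.sum_localKernel hq1 w)]
  exact Finset.single_le_sum (fun y _ => A.causalWeight_localKernel_nonneg hq w y)
    (Finset.mem_univ y)

theorem measurable_causalWeight_localKernel (A : N.Algorithm W Z T)
    (y : Fin T → ∀ e : {e : N.edges // e.1.2 ∈ S}, N.Y e.1) :
    Measurable fun w : ∀ v : S, W v => causalWeight (A.localKernel q w) y :=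
  Finset.measurable_prod _ fun t _ => A.measurable_localKernel t _ _

theorem sum_refLikelihood (A : N.Algorithm W Z T) (hq1 : ∀ t e, ∑ b, q t e b = 1)
    (w : ∀ v, W v) : ∑ y, A.refLikelihood S q w y = 1 := by
  have := A.sum_refLikelihood_mul (S := S) (q := q) w fun _ => 1
  simp only [mul_one] at this
  rw [this, sum_causalWeight _ (A.sum_localKernel hq1 _)]

theorem integrable_refLikelihood_mul_indicator (A : N.Algorithm W Z T) (μ : Measure (∀ v, W v))
    [IsFiniteMeasure μ] (hq : ∀ t e b, 0 ≤ q t e b) (hq1 : ∀ t e, ∑ b, q t e b = 1)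
    (y : Fin T → ∀ e, N.Y e) {G : Set (∀ v, W v)} (hG : MeasurableSet G) :
    Integrable (fun w => A.refLikelihood S q w y * G.indicator 1 w) μ :=
  Integrable.of_bound ((A.measurable_refLikelihood y).mul
    (measurable_one.indicator hG)).aestronglyMeasurable 1 (.of_forall fun w => by
      rw [norm_mul, Real.norm_of_nonneg (A.refLikelihood_nonneg hq w y)]
      refine mul_le_one₀ (A.refLikelihood_le_one hq hq1 w y) (norm_nonneg _) ?_
      by_cases hw : w ∈ G <;> simp [hw])

end Reference

variable [Fintype V]

/-- Under the reference law no node of `S` can estimate the sum well. -/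
theorem sum_integral_refLikelihood_le (A : N.Algorithm (fun _ => ℝ) ℝ T) (a : V → ℝ)
    {S : Finset V} (ha : 0 < ∑ v ∈ Sᶜ, a v ^ 2) {ε : ℝ} (hε : 0 ≤ ε) {v : V} (hv : v ∈ S)
    {q : Fin T → ∀ e, N.Y e → ℝ} (hq : ∀ t e b, 0 ≤ q t e b) (hq1 : ∀ t e, ∑ b, q t e b = 1)
    (hG : ∀ y, MeasurableSet {w : V → ℝ | |∑ v, a v * w v - A.estimate v (w, y)| ≤ ε}) :
    ∑ y, ∫ w, A.refLikelihood S q w y *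
        {w : V → ℝ | |∑ v, a v * w v - A.estimate v (w, y)| ≤ ε}.indicator 1 w
        ∂(Measure.pi fun _ : V => gaussianReal 0 1) ≤
      2 * ε / Real.sqrt (2 * Real.pi * ∑ v ∈ Sᶜ, a v ^ 2) := by
  set μ : Measure (V → ℝ) := Measure.pi fun _ : V => gaussianReal 0 1
  set L := 2 * ε / Real.sqrt (2 * Real.pi * ∑ v ∈ Sᶜ, a v ^ 2)
  -- All edges entering `v` end in `S`, so the estimate at `v` is a function of the data available
  -- in `S`.
  let z : (Fin T → ∀ e : {e : N.edges // e.1.2 ∈ S}, N.Y e.1) → (S → ℝ) → ℝ := fun yS x =>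
    A.est v (x ⟨v, hv⟩) fun t e => yS t ⟨e.1, (congrArg (· ∈ S) e.2).mpr hv⟩
  have hz : ∀ yS, Measurable (z yS) := fun yS =>
    (A.measurable_est v _).comp (measurable_pi_apply (⟨v, hv⟩ : S))
  let D : (Fin T → ∀ e : {e : N.edges // e.1.2 ∈ S}, N.Y e.1) → Set (V → ℝ) := fun yS =>
    {w : V → ℝ | |∑ v, a v * w v - z yS fun v : S => w v| ≤ ε}
  have hr : Measurable fun (w : V → ℝ) (v : S) => w v :=
    measurable_pi_lambda _ fun v => measurable_pi_apply _
  have hD : ∀ yS, MeasurableSet (D yS) := fun yS => by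
    refine measurableSet_le (continuous_abs.measurable.comp (Measurable.sub
      (Finset.measurable_sum _ fun v _ => ?_) ?_)) measurable_const
    · exact (measurable_const_mul (a v)).comp (measurable_pi_apply v)
    · exact (hz yS).comp hr
  have hm : ∀ yS, Measurable fun w : S → ℝ => causalWeight (A.localKernel q w) yS := fun yS =>
    A.measurable_causalWeight_localKernel yS
  have i1 : ∀ yS, Integrable (fun w : V → ℝ =>
      causalWeight (A.localKernel q fun v : S => w v) yS) μ := fun yS =>
    Integrable.of_bound ((hm yS).comp hr).aestronglyMeasurable 1 (.of_forall fun w => by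
      rw [Real.norm_of_nonneg (A.causalWeight_localKernel_nonneg hq _ yS)]
      exact A.causalWeight_localKernel_le_one hq hq1 _ yS)
  have i2 : ∀ yS, Integrable (fun w : V → ℝ =>
      causalWeight (A.localKernel q fun v : S => w v) yS * (D yS).indicator 1 w) μ := fun yS =>
    Integrable.of_bound (((hm yS).comp hr).mul
      (measurable_one.indicator (hD yS))).aestronglyMeasurable 1 (.of_forall fun w => by
        rw [norm_mul, Real.norm_of_nonneg (A.causalWeight_localKernel_nonneg hq _ yS)]
        refine mul_le_one₀ (A.causalWeight_localKernel_le_one hq hq1 _ yS) (norm_nonneg _) ?_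
        by_cases hw : w ∈ D yS <;> simp [hw])
  calc _ = ∫ w, ∑ y, A.refLikelihood S q w y *
        {w : V → ℝ | |∑ v, a v * w v - A.estimate v (w, y)| ≤ ε}.indicator 1 w ∂μ :=
        (integral_finsetSum _ fun y _ =>
          A.integrable_refLikelihood_mul_indicator μ hq hq1 y (hG y)).symm
    _ = ∫ w, ∑ yS, causalWeight (A.localKernel q fun v : S => w v) yS *
          (D yS).indicator 1 w ∂μ := by
        refine integral_congr_ae (.of_forall fun w => ?_)
        exact A.sum_refLikelihood_mul w fun yS => (D yS).indicator 1 w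
    _ = ∑ yS, ∫ w, causalWeight (A.localKernel q fun v : S => w v) yS *
          (D yS).indicator 1 w ∂μ := integral_finsetSum _ fun yS _ => i2 yS
    _ ≤ ∑ yS, L * ∫ w, causalWeight (A.localKernel q fun v : S => w v) yS ∂μ :=
        Finset.sum_le_sum fun yS _ => integral_mul_indicator_abs_sub_le a S ha hε (hm yS) (hz yS)
          (fun x => A.causalWeight_localKernel_nonneg hq x yS)
          fun x => A.causalWeight_localKernel_le_one hq hq1 x yS
    _ = L := by
        rw [← Finset.mul_sum, ← integral_finsetSum _ fun yS _ => i1 yS]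
        simp [sum_causalWeight _ (A.sum_localKernel hq1 _)]

/-- The cutset bound on the accuracy of an algorithm for a Gaussian sum. -/
theorem gaussian_sum_cutset_bound (A : N.Algorithm (fun _ => ℝ) ℝ T) (a : V → ℝ)
    {S : Finset V} {u v : V} (hu : u ∉ S) (hv : v ∈ S) (ha : a u ≠ 0) {ε δ : ℝ} (hε : 0 < ε)
    (hδ : 0 ≤ δ) (hδ' : δ < 1) (hacc : ε ≤ Real.sqrt (Real.pi / 2) * (1 - δ) * |a u|)
    (hA : A.jointLaw (Measure.pi fun _ => gaussianReal 0 1)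
      {p | ε < |∑ v, a v * p.1 v - A.estimate v p|} ≤ ENNReal.ofReal δ) :
    ENNReal.ofReal ((1 - δ) / 2 * Real.logb 2 ((Real.pi * ∑ v ∈ Sᶜ, a v ^ 2) / (2 * ε ^ 2)) -
      binEntropyBits δ) ≤ T * N.cutsetCapacity S := by
  set μ : Measure (V → ℝ) := Measure.pi fun _ : V => gaussianReal 0 1
  set σ := ∑ v ∈ Sᶜ, a v ^ 2 with hσ
  have hau : a u ^ 2 ≤ σ := Finset.single_le_sum (f := fun v => a v ^ 2)
    (fun _ _ => sq_nonneg _) (Finset.mem_compl.2 hu)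
  have hσ0 : 0 < σ := lt_of_lt_of_le (by positivity) hau
  have hπ := Real.pi_pos
  set L := 2 * ε / Real.sqrt (2 * Real.pi * σ) with hLdef
  have hL : 0 < L := by positivity
  have h1δ : 0 < 1 - δ := by linarith
  -- The accuracy hypothesis enters here: `2 √(π/2) |a u| = √(2π) |a u| ≤ √(2πσ)`.
  have hL1 : L ≤ 1 - δ := by
    have h1 : 2 * Real.sqrt (Real.pi / 2) * |a u| ≤ Real.sqrt (2 * Real.pi * σ) := by
      refine Real.le_sqrt_of_sq_le ?_
      rw [mul_pow, mul_pow, Real.sq_sqrt (by positivity), sq_abs]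
      nlinarith
    rw [hLdef, div_le_iff₀ (by positivity)]
    have h2 := mul_le_mul_of_nonneg_left h1 h1δ.le
    linarith
  have hlogL : -Real.log L = Real.log (Real.pi * σ / (2 * ε ^ 2)) / 2 := by
    have h1 : L ^ 2 = (Real.pi * σ / (2 * ε ^ 2))⁻¹ := by
      rw [hLdef, div_pow, Real.sq_sqrt (by positivity)]
      field_simp
    have h2 := congrArg Real.log h1
    rw [Real.log_pow, Real.log_inv] at h2
    push_cast at h2
    linarith
  let G : (Fin T → ∀ e, N.Y e) → Set (V → ℝ) := fun y =>
    {w | |∑ v, a v * w v - A.estimate v (w, y)| ≤ ε}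
  have hG : ∀ y, MeasurableSet (G y) := fun y => by
    refine measurableSet_le (continuous_abs.measurable.comp (Measurable.sub
      (Finset.measurable_sum _ fun v _ => ?_) ?_)) measurable_const
    · exact (measurable_const_mul (a v)).comp (measurable_pi_apply v)
    · exact (A.measurable_est v fun t e => y t e.1).comp (measurable_pi_apply (X := fun _ : V => ℝ) v)
  set p := ∑ y, ∫ w, A.likelihood w y * (G y).indicator 1 w ∂μ with hpdef
  have hp : 1 - δ ≤ p := by
    have h1 := (A.ofReal_sum_integral_likelihood_le_jointLaw μ
      {p | ε < |∑ v, a v * p.1 v - A.estimate v p|} fun y => by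
        convert (hG y).compl using 1
        ext w
        simp [G]).trans hA
    rw [ENNReal.ofReal_le_ofReal_iff hδ] at h1
    have iI : ∀ y (E : Set (V → ℝ)), MeasurableSet E →
        Integrable (fun w => A.likelihood w y * E.indicator 1 w) μ := fun y E hE =>
      A.integrable_likelihood_mul μ y (measurable_one.indicator hE) (C := 1) fun w => by
        by_cases hw : w ∈ E <;> simp [hw]
    have h2 : ∀ y, {w : V → ℝ | (w, y) ∈ {p : (V → ℝ) × (Fin T → ∀ e, N.Y e) |
        ε < |∑ v, a v * p.1 v - A.estimate v p|}} = (G y)ᶜ := fun y => by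
      ext w
      simp [G]
    simp only [h2] at h1
    have h3 : p + ∑ y, ∫ w, A.likelihood w y * (G y)ᶜ.indicator 1 w ∂μ = 1 := by
      rw [hpdef, ← Finset.sum_add_distrib]
      have h4 : ∀ y, (∫ w, A.likelihood w y * (G y).indicator 1 w ∂μ) +
          ∫ w, A.likelihood w y * (G y)ᶜ.indicator 1 w ∂μ = ∫ w, A.likelihood w y ∂μ := fun y => by
        rw [← integral_add (iI y _ (hG y)) (iI y _ (hG y).compl)]
        refine integral_congr_ae (.of_forall fun w => ?_)
        by_cases hw : w ∈ G y <;> simp [hw]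
      simp only [h4]
      rw [← integral_finsetSum _ fun y _ => by simpa using iI y Set.univ MeasurableSet.univ]
      simp [sum_likelihood]
    linarith
  set I := ∑ t, ∑ e : N.edges with e.1.1 ∉ S ∧ e.1.2 ∈ S, ∑ y, ∫ w, A.likelihood w y *
    Real.log (N.K e (A.input w y t e) (y t e) / A.outputLaw μ t e (y t e)) ∂μ with hI
  have hdiv : (1 - δ) * -Real.log L + (1 - δ) * Real.log (1 - δ) + δ * Real.log δ ≤ I := by
    -- The side condition holds since `δ * L ≤ L ≤ 1 - δ`.
    refine binary_divergence_le hδ hδ' hp hL (by nlinarith) fun α β hα hβ => ?_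
    have h1 := A.change_of_measure μ S G hG hα hβ
    have hq : ∀ t e b, 0 ≤ A.outputLaw μ t e b := A.outputLaw_nonneg μ
    have hq1 : ∀ t e, ∑ b, A.outputLaw μ t e b = 1 := A.sum_outputLaw μ
    have h2 := mul_le_mul_of_nonneg_left
      (A.sum_integral_refLikelihood_le a hσ0 hε.le hv hq hq1 hG) hα.le
    have h3 : ∑ y, ∫ w, A.refLikelihood S (A.outputLaw μ) w y ∂μ = 1 := by
      rw [← integral_finsetSum _ fun y _ => by
        simpa using A.integrable_refLikelihood_mul_indicator μ hq hq1 y MeasurableSet.univ]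
      simp [A.sum_refLikelihood hq1]
    rw [h3, mul_one] at h1
    exact h1.trans (sub_le_sub_right (add_le_add_left h2 β) 1)
  refine le_trans (ENNReal.ofReal_le_ofReal ?_) (A.ofReal_sum_information_le μ S)
  have hl2 : 0 < Real.log 2 := Real.log_pos one_lt_two
  rw [← hI, le_div_iff₀ hl2]
  refine le_trans (le_of_eq ?_) hdiv
  rw [hlogL, binEntropyBits, Real.logb, Real.logb, Real.logb]
  field_simp
  ring


end Network.Algorithm

/-! ### Extended values and the limit of vanishing error -/

theorem toENNReal_gaussianSumInfo {V : Type*} [Fintype V] [DecidableEq V] (a : V → ℝ)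
    {S : Finset V} (hS : 0 < ∑ v ∈ Sᶜ, a v ^ 2) {ε : ℝ} (hε : 0 < ε) (δ : ℝ) :
    (gaussianSumInfo a S ε δ).toENNReal = ENNReal.ofReal ((1 - δ) / 2 *
      Real.logb 2 ((Real.pi * ∑ v ∈ Sᶜ, a v ^ 2) / (2 * ε ^ 2)) - binEntropyBits δ) := by
  have hπ := Real.pi_pos
  rw [gaussianSumInfo, binLog, ← ENNReal.ofReal_div_of_pos (by positivity),
    ENNReal.log_ofReal_of_pos (by positivity), ← EReal.coe_div, ← EReal.coe_mul, ← EReal.coe_sub,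
    EReal.toENNReal_of_ne_top (EReal.coe_ne_top _), EReal.toReal_coe, Real.logb]

/-- Serves the case `ε = 0`, where the numerator is infinite; `δ < 1` keeps the coefficient of the
logarithm positive. -/
theorem tendsto_gaussian_info_atTop {s δ h : ℝ} (hs : 0 < s) (hδ : δ < 1) :
    Filter.Tendsto (fun ε : ℝ => ENNReal.ofReal ((1 - δ) / 2 * Real.logb 2 (s / (2 * ε ^ 2)) - h))
      (nhdsWithin 0 (Set.Ioi 0)) (nhds ⊤) := by
  refine ENNReal.tendsto_ofReal_atTop.comp ?_
  have h1 : Filter.Tendsto (fun ε : ℝ => 2 * ε ^ 2) (nhdsWithin 0 (Set.Ioi 0))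
      (nhdsWithin 0 (Set.Ioi 0)) := by
    refine tendsto_nhdsWithin_iff.2 ⟨?_, ?_⟩
    · refine tendsto_nhdsWithin_of_tendsto_nhds ?_
      have : Continuous fun ε : ℝ => 2 * ε ^ 2 := by fun_prop
      simpa using this.tendsto 0
    · filter_upwards [self_mem_nhdsWithin] with ε hε
      have : 0 < ε := hε
      exact Set.mem_Ioi.2 (by positivity)
  have h2 : Filter.Tendsto (fun ε : ℝ => s / (2 * ε ^ 2)) (nhdsWithin 0 (Set.Ioi 0))
      Filter.atTop := by
    simp only [div_eq_mul_inv]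
    exact (tendsto_inv_nhdsGT_zero.comp h1).const_mul_atTop hs
  have h3 := ((Real.tendsto_logb_atTop one_lt_two).comp h2).const_mul_atTop
    (show (0 : ℝ) < (1 - δ) / 2 by linarith)
  exact Filter.tendsto_atTop_add_const_right _ (-h) h3

end

/-- Since the computation time is nonnegative, only the positive part of the numerator matters; the
quotient in `ℝ≥0∞` is `⊤` if the numerator is positive and the cutset capacity is zero, and `0 / 0 = 0`. -/
theorem mainTheorem9 {V : Type*} [Fintype V] [DecidableEq V] (N : Network V) (a : V → ℝ)
    (ha : ∀ v, a v ≠ 0) (ε δ : ℝ) (hε : 0 ≤ ε) (hδ : 0 ≤ δ) (hδ' : δ < 1)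
    (hacc : ∀ v, ε ≤ Real.sqrt (Real.pi / 2) * (1 - δ) * |a v|) :
    (⨆ S ∈ {S : Finset V | S.Nonempty ∧ S ≠ Finset.univ},
        (gaussianSumInfo a S ε δ).toENNReal / N.cutsetCapacity S) ≤
      (N.computationTime (W := fun _ => ℝ) (Measure.pi fun _ => gaussianReal 0 1)
        (fun w => ∑ v, a v * w v) (fun z z' => |z - z'|) ε δ : ℝ≥0∞) := by
  refine iSup₂_le fun S ⟨⟨v, hv⟩, hS⟩ => ?_
  obtain ⟨u, hu⟩ : ∃ u, u ∉ S := by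
    by_contra! h
    exact hS (Finset.eq_univ_iff_forall.2 h)
  have hσ : 0 < ∑ v ∈ Sᶜ, a v ^ 2 := Finset.sum_pos (fun v _ => sq_pos_of_ne_zero (ha v))
    ⟨u, Finset.mem_compl.2 hu⟩
  rw [Network.computationTime]
  simp only [ENat.toENNReal_iInf]
  refine le_iInf₂ fun T ⟨A, hA⟩ => ?_
  rw [ENat.toENNReal_coe]
  -- In product form a vanishing cutset capacity needs no separate case.
  refine ENNReal.div_le_of_le_mul ?_
  rcases hε.eq_or_lt with rfl | hpos
  -- An algorithm for `ε = 0` also meets every accuracy `η > 0`; the bound for small `η` forces `T *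
  -- C_S` to be infinite.
  · have htop : (⊤ : ℝ≥0∞) ≤ T * N.cutsetCapacity S := by
      refine le_of_tendsto (tendsto_gaussian_info_atTop (h := binEntropyBits δ)
        (mul_pos Real.pi_pos hσ) hδ') ?_
      have hpos : 0 < Real.sqrt (Real.pi / 2) * (1 - δ) * |a u| := by
        have := abs_pos.2 (ha u)
        have := Real.pi_pos
        have : 0 < 1 - δ := by linarith
        positivity
      filter_upwards [Ioo_mem_nhdsGT hpos] with η hη
      refine A.gaussian_sum_cutset_bound a hu hv (ha u) hη.1 hδ hδ' hη.2.le
        ((measure_mono fun p hp => ?_).trans (hA v))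
      exact hη.1.trans hp
    exact le_top.trans htop
  · rw [toENNReal_gaussianSumInfo a hσ hpos]
    exact A.gaussian_sum_cutset_bound a hu hv (ha u) hpos hδ hδ' (hacc u) (hA v)
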